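/- Let $E$ be the elliptic curve over $\mathbb{Q}$ given by $y^2=x^3-8x^2-2x$. A prime $p$ is called a supersingular prime of $E$ if $E$ has good reduction at $p$ and the reduction $\tilde E$ of $E$ modulo $p$ is supersingular, that is, $\tilde E(\overline{\mathbb{F}}_p)$ has no point of order $p$. Then every supersingular prime $p$ of $E$ satisfies $p\equiv 5 \pmod{24}$ or $p\equiv 23\pmod{24}$. -/

import Mathlib

namespace WeierstrassCurve

open scoped Classical in
/-- A Weierstrass curve `W` over a field `k` of positive characteristic `p = ringChar k` is a
supersingular elliptic curve if it is smooth and the group of its points over an algebraic closure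
of `k` has no nonzero `p`-torsion point. (In characteristic zero this is never satisfied, because
`0 • P = 0` for the nonzero torsion points of order two.) -/
def IsSupersingular {k : Type*} [Field k] (W : WeierstrassCurve k) : Prop :=
  W.IsElliptic ∧
    ∀ P : (W.baseChange (AlgebraicClosure k)).toAffine.Point, ringChar k • P = 0 → P = 0

/-- A Weierstrass curve over the fraction field of a discrete valuation ring `R` has supersingular
reduction if a minimal Weierstrass equation for it has good reduction and its reduction is a
supersingular elliptic curve over the residue field of `R`. -/
def HasSupersingularReduction (R : Type*) [CommRing R] [IsDomain R] [IsDiscreteValuationRing R]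
    {K : Type*} [Field K] [Algebra R K] [IsFractionRing R K] (W : WeierstrassCurve K) : Prop :=
  (W.minimal R).HasGoodReduction R ∧ ((W.minimal R).reduction R).IsSupersingular

/-- The prime `p` is a supersingular prime of the curve `W` over `ℚ`: the base change of `W` to
`ℚ_[p]` has good, supersingular reduction. -/
def IsSupersingularPrime (W : WeierstrassCurve ℚ) (p : ℕ) [Fact p.Prime] : Prop :=
  (W.baseChange ℚ_[p]).HasSupersingularReduction ℤ_[p]

end WeierstrassCurve

/-- The elliptic curve `y ^ 2 = x ^ 3 - 8 x ^ 2 - 2 x` over `ℚ`. -/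
def curveE : WeierstrassCurve ℚ where
  a₁ := 0
  a₂ := -8
  a₃ := 0
  a₄ := -2
  a₆ := 0

/-!
Let `χ` be the quadratic character of the residue field `k = 𝔽_p` and `f(x) = x³ - 8x² - 2x`. The
proof shows that `S = ∑ x : k, χ (f x)`, the negative of the trace of Frobenius, vanishes at a
supersingular prime, and that `S` is nonzero modulo `8` unless `p ≡ 5, 23 [MOD 24]`.

*Vanishing.* The discriminant of any model of `E` is `4608 = 2⁹ 3²` times a twelfth power, so good
reduction excludes `p = 2` and `p = 3`; for `p ≥ 5` a model with unit discriminant is related to the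
given one by a change of variables over `ℤ_[p]` (`exists_variableChange_of_isUnit_Δ`), which leaves
the character sum unchanged. Over a finite field with `q` elements, Euler's criterion gives
`#W(𝔽_q) = 1 - A` in `𝔽_q`, where the Hasse invariant `A` is the coefficient of `x ^ (q - 1)` in the
power `(q - 1) / 2` of the two-torsion polynomial (`natCast_card_point`), and over the extension of
degree `n` the invariant becomes `A ^ n` (`hasseCoeff_map`). If `A ≠ 0`, then for `n = q - 1` the
number of points is divisible by `p`, and there is a point of order `p`. Hence supersingularity
forces `A = 0`, that is `p ∣ S`. As `f 0 = 0`, trivially `|S| < p`, so `S = 0`.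

*Congruences.* Grouping the `x` by `t = x - 2 / x`, and then the `t` by `w = t²`, gives
`S ≡ (explicit terms) + 4 N [ZMOD 8]`, where `N` is the number of `w` for which `w`, `w + 8` and
`64 - w` are all nonzero squares (`sum_modEq_card_squareTriples`). For `p ≡ 1 [MOD 8]` the explicit
terms give `S ≡ 2 [ZMOD 4]`. In the other cases the parity of `N` matters. For `p ≡ 3 [MOD 8]` and
`p ≡ 7 [MOD 24]` it is read off from the fixed points of an involution of the set of these `w`, a
Möbius transformation permuting `0`, `-8`, `64` and `∞`. For `p ≡ 13 [MOD 24]` no such involution is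
available; there `∏ (64 - w) / 2`, over all `w` with `w` and `w + 8` nonzero squares, is evaluated
to be `±6` by writing `w = 2 (v - 1)² / v` with `v` a nonsquare, which determines the parity of the
number of `w` with `64 - w` a square. In all these cases `S ≡ 4 [ZMOD 8]`.
-/

open Finset Polynomial

section CharacterSums

variable {F : Type*} [Field F] [Fintype F] [DecidableEq F]

/-! ### The character sum modulo 8 -/

/-- The substitution `y = 2 x - t` identifies the solutions of `x + b / x = t` with the square roots
of `t ^ 2 - 4 * b`. -/
theorem card_sub_div_eq (hF : ringChar F ≠ 2) {b : F} (hb : b ≠ 0) (t : F) :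
    (#{x : F | x ≠ 0 ∧ x + b / x = t} : ℤ) = 1 + quadraticChar F (t ^ 2 - 4 * b) := by
  have h2 : (2 : F) ≠ 0 := Ring.two_ne_zero hF
  rw [add_comm, ← quadraticChar_card_sqrts hF, Nat.cast_inj]
  refine card_bij' (fun x _ => 2 * x - t) (fun y _ => (y + t) / 2) ?_ ?_ ?_ ?_
  · intro x hx
    simp only [mem_filter, mem_univ, true_and, Set.mem_toFinset, Set.mem_ofPred_eq] at hx ⊢
    obtain ⟨hx0, rfl⟩ := hx
    field_simp
    ring
  · intro y hy
    simp only [mem_filter, mem_univ, true_and, Set.mem_toFinset, Set.mem_ofPred_eq] at hy ⊢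
    have hne : y + t ≠ 0 := by
      intro h
      have : 2 * 2 * b = 0 := by linear_combination (t - y) * h + hy
      simp_all
    refine ⟨div_ne_zero hne h2, ?_⟩
    field_simp
    linear_combination hy
  · intro x _
    field_simp
    ring
  · intro y _
    field_simp
    ring

/-- The character sum of `y² = x³ + ax² + bx` is that of its `2`-isogenous curve: group the `x` by
the value of `x + b / x`. -/
theorem sum_quadraticChar_cubic (hF : ringChar F ≠ 2) (a : F) {b : F} (hb : b ≠ 0) :
    ∑ x : F, quadraticChar F (x ^ 3 + a * x ^ 2 + b * x) =
      ∑ t : F, quadraticChar F (t + a) * (1 + quadraticChar F (t ^ 2 - 4 * b)) := by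
  have h1 : ∑ x : F, quadraticChar F (x ^ 3 + a * x ^ 2 + b * x) =
      ∑ x : F with x ≠ 0, quadraticChar F (x + b / x + a) := by
    rw [sum_filter]
    refine sum_congr rfl fun x _ => ?_
    split_ifs with hx
    · rw [show x ^ 3 + a * x ^ 2 + b * x = x ^ 2 * (x + b / x + a) by field_simp; ring, map_mul,
        quadraticChar_sq_one' hx, one_mul]
    · rw [not_not] at hx
      simp [hx]
  rw [h1, ← sum_fiberwise _ (fun x => x + b / x)]
  refine sum_congr rfl fun t _ => ?_
  rw [← card_sub_div_eq hF hb, filter_filter, mul_comm, ← nsmul_eq_mul, ← sum_const]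
  refine sum_congr rfl fun x hx => ?_
  rw [(mem_filter.mp hx).2.2]

/-- The sum of `χ(t - 8)` over the square roots `t` of `w`. -/
def sqrtSum (F : Type*) [Field F] [Fintype F] [DecidableEq F] (w : F) : ℤ :=
  ∑ t : F with t ^ 2 = w, quadraticChar F (t - 8)

theorem sum_eq_sum_sqrtSum (hF : ringChar F ≠ 2) :
    ∑ x : F, quadraticChar F (x ^ 3 - 8 * x ^ 2 - 2 * x) =
      ∑ w : F, (1 + quadraticChar F (w + 8)) * sqrtSum F w := by
  have h2 : (2 : F) ≠ 0 := Ring.two_ne_zero hF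
  have := sum_quadraticChar_cubic hF (-8) (neg_ne_zero.mpr h2)
  rw [← sum_fiberwise univ (fun t => t ^ 2) (fun t : F => quadraticChar F (t + -8) *
    (1 + quadraticChar F (t ^ 2 - 4 * -2)))] at this
  convert this using 1
  · refine sum_congr rfl fun x _ => ?_
    ring_nf
  · refine sum_congr rfl fun w _ => ?_
    rw [sqrtSum, mul_sum]
    refine sum_congr rfl fun t ht => ?_
    rw [mul_comm, ← (mem_filter.mp ht).2]
    ring_nf

theorem sqrtSum_of_not_isSquare {w : F} (hw : quadraticChar F w = -1) : sqrtSum F w = 0 := by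
  rw [sqrtSum, filter_false_of_mem, sum_empty]
  rintro t - rfl
  exact quadraticChar_neg_one_iff_not_isSquare.mp hw (IsSquare.sq t)

theorem sqrtSum_zero : sqrtSum F 0 = quadraticChar F (-8) := by
  simp [sqrtSum, filter_eq']

theorem sqrtSum_sq (hF : ringChar F ≠ 2) {r : F} (hr : r ≠ 0) :
    sqrtSum F (r ^ 2) = quadraticChar F (r - 8) + quadraticChar F (-r - 8) := by
  have h2 : (2 : F) ≠ 0 := Ring.two_ne_zero hF
  have hne : r ≠ -r := fun h => hr (by
    have : 2 * r = 0 := by linear_combination h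
    simpa [h2] using this)
  have : ({t : F | t ^ 2 = r ^ 2} : Finset F) = {r, -r} := by
    ext t
    simp [sq_eq_sq_iff_eq_or_eq_neg]
  rw [sqrtSum, this, sum_pair hne]

/-- For signs `a` and `b`, the sum `a + b` is `1 + a * b` modulo `4`. -/
theorem sqrtSum_modEq (hF : ringChar F ≠ 2) {w : F} (hw : quadraticChar F w = 1) (hw' : w ≠ 64) :
    sqrtSum F w ≡ 1 + quadraticChar F (64 - w) [ZMOD 4] := by
  have hw0 : w ≠ 0 := by rintro rfl; simp at hw
  obtain ⟨r, rfl⟩ := (quadraticChar_one_iff_isSquare hw0).mp hw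
  have hr : r ≠ 0 := by rintro rfl; simp at hw0
  rw [← sq, sqrtSum_sq hF hr]
  have h1 : r - 8 ≠ 0 := fun h => hw' (by linear_combination (r + 8) * h)
  have h2 : -r - 8 ≠ 0 := fun h => hw' (by linear_combination (8 - r) * h)
  rw [show 64 - r ^ 2 = (r - 8) * (-r - 8) by ring, map_mul]
  rcases quadraticChar_dichotomy h1 with h1 | h1 <;> rcases quadraticChar_dichotomy h2 with h2 | h2
    <;> rw [h1, h2] <;> decide

/-- The `w` for which `w`, `w + 8` and `64 - w` are nonzero squares. -/
def squareTriples (F : Type*) [Field F] [Fintype F] [DecidableEq F] : Finset F :=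
  {w | quadraticChar F w = 1 ∧ quadraticChar F (w + 8) = 1 ∧ quadraticChar F (64 - w) = 1}

theorem mem_squareTriples {w : F} : w ∈ squareTriples F ↔ quadraticChar F w = 1 ∧
    quadraticChar F (w + 8) = 1 ∧ quadraticChar F (64 - w) = 1 := by
  simp [squareTriples]

/-- The three terms besides `4 N` come from `w = -8`, where `w + 8` vanishes, and from `w = 0` and
`w = 64`, where `χ (t - 8) + χ (-t - 8)` does not consist of two nonzero terms. -/
theorem sum_modEq_card_squareTriples (hF : ringChar F ≠ 2) (h3 : (3 : F) ≠ 0) :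
    ∑ x : F, quadraticChar F (x ^ 3 - 8 * x ^ 2 - 2 * x) ≡
      sqrtSum F (-8) + (1 + quadraticChar F 2) * (quadraticChar F (-2) + quadraticChar F (-1)) +
        4 * #(squareTriples F) [ZMOD 8] := by
  have h2 : (2 : F) ≠ 0 := Ring.two_ne_zero hF
  have c8 : quadraticChar F 8 = quadraticChar F 2 := by
    rw [show (8 : F) = 2 ^ 2 * 2 by norm_num, map_mul, quadraticChar_sq_one' h2, one_mul]
  have cm8 : quadraticChar F (-8) = quadraticChar F (-2) := by
    rw [show (-8 : F) = 2 ^ 2 * -2 by norm_num, map_mul, quadraticChar_sq_one' h2, one_mul]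
  have c72 : quadraticChar F 72 = quadraticChar F 2 := by
    rw [show (72 : F) = (2 * 3) ^ 2 * 2 by norm_num, map_mul,
      quadraticChar_sq_one' (mul_ne_zero h2 h3), one_mul]
  have n8 : (8 : F) ≠ 0 := by
    rw [show (8 : F) = 2 ^ 3 by norm_num]; exact pow_ne_zero _ h2
  have n72 : (72 : F) ≠ 0 := by
    rw [show (72 : F) = 2 ^ 3 * 3 ^ 2 by norm_num]
    exact mul_ne_zero (pow_ne_zero _ h2) (pow_ne_zero _ h3)
  have n64 : (64 : F) ≠ 0 := by
    rw [show (64 : F) = 2 ^ 6 by norm_num]; exact pow_ne_zero _ h2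
  have g64 : sqrtSum F 64 = quadraticChar F (-1) := by
    rw [show (64 : F) = 8 ^ 2 by norm_num, sqrtSum_sq hF n8,
      show (-8 - 8 : F) = (2 ^ 2) ^ 2 * -1 by norm_num, map_mul,
      quadraticChar_sq_one' (pow_ne_zero _ h2)]
    simp
  have key : ∀ w : F, (1 + quadraticChar F (w + 8)) * sqrtSum F w ≡
      (if w = -8 then sqrtSum F (-8) else 0) +
      (if w = 0 then (1 + quadraticChar F 2) * quadraticChar F (-2) else 0) +
      (if w = 64 then (1 + quadraticChar F 2) * quadraticChar F (-1) else 0) +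
      4 * (if w ∈ squareTriples F then 1 else 0) [ZMOD 8] := by
    intro w
    by_cases e8 : w = -8
    · have e0 : (-8 : F) ≠ 0 := neg_ne_zero.mpr n8
      have e64 : (-8 : F) ≠ 64 := fun h => n72 (by linear_combination -h)
      simp [e8, mem_squareTriples, n8, e64, Int.ModEq]
    by_cases e0 : w = 0
    · simp [e0, mem_squareTriples, n8, n64.symm, sqrtSum_zero, cm8, c8, Int.ModEq]
    by_cases e64 : w = 64
    · have e8 : (64 : F) ≠ -8 := fun h => n72 (by linear_combination h)
      simp [e64, mem_squareTriples, n64, e8, g64, Int.ModEq, show (64 + 8 : F) = 72 by norm_num,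
        c72]
    simp only [e8, e0, e64, if_false, zero_add]
    have e8' : w + 8 ≠ 0 := fun h => e8 (by linear_combination h)
    have e64' : 64 - w ≠ 0 := fun h => e64 (by linear_combination -h)
    rcases quadraticChar_dichotomy e8' with h8 | h8
    · rcases quadraticChar_dichotomy e0 with h0 | h0
      · have := sqrtSum_modEq hF h0 e64
        rw [h8]
        rcases quadraticChar_dichotomy e64' with h64 | h64 <;> rw [h64] at this <;>
          simp only [mem_squareTriples, h0, h8, h64] <;> simp [Int.ModEq] at this ⊢ <;> omega
      · simp [mem_squareTriples, h0, sqrtSum_of_not_isSquare h0, Int.ModEq]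
    · simp [mem_squareTriples, h8, Int.ModEq]
  rw [sum_eq_sum_sqrtSum hF]
  have hs := Int.ModEq.sum (s := univ) fun w _ => key w
  rw [sum_add_distrib, sum_add_distrib, sum_add_distrib, ← mul_sum] at hs
  simpa [mul_add, add_assoc] using hs

/-! ### Parity by involutions -/

theorem Finset.even_card_of_involution_of_ne {α : Type*} [DecidableEq α] (s : Finset α) (σ : α → α)
    (hmem : ∀ a ∈ s, σ a ∈ s) (hσ : ∀ a ∈ s, σ (σ a) = a) (hne : ∀ a ∈ s, σ a ≠ a) :
    Even #s := by
  rw [← ZMod.natCast_eq_zero_iff_even, card_eq_sum_ones, Nat.cast_sum]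
  exact sum_involution (fun a _ => σ a) (fun _ _ => by decide) (fun a ha _ => hne a ha)
    (fun a ha => hmem a ha) hσ

theorem quadraticChar_sq_mul {a : F} (ha : a ≠ 0) (b : F) :
    quadraticChar F (a ^ 2 * b) = quadraticChar F b := by
  rw [map_mul, quadraticChar_sq_one' ha, one_mul]

theorem quadraticChar_two_eq (hF : ringChar F ≠ 2) :
    quadraticChar F 2 =
      if Fintype.card F % 8 = 1 ∨ Fintype.card F % 8 = 7 then 1 else -1 := by
  have h := FiniteField.odd_card_of_char_ne_two hF
  rw [quadraticChar_two hF, ZMod.χ₈_nat_eq_if_mod_eight, if_neg (by omega)]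

theorem quadraticChar_neg_one_eq (hF : ringChar F ≠ 2) :
    quadraticChar F (-1) = if Fintype.card F % 4 = 1 then 1 else -1 := by
  have h := FiniteField.odd_card_of_char_ne_two hF
  rw [quadraticChar_neg_one hF, ZMod.χ₄_nat_eq_if_mod_four, if_neg (by omega)]

theorem ne_zero_of_mem_squareTriples {w : F} (hw : w ∈ squareTriples F) :
    w ≠ 0 ∧ w + 8 ≠ 0 ∧ 64 - w ≠ 0 := by
  obtain ⟨h1, h2, h3⟩ := mem_squareTriples.mp hw
  refine ⟨?_, ?_, ?_⟩ <;> intro h <;> simp [h] at h1 h2 h3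

/-- The involution `w ↦ -512 / w` fixes `16 s` and `-16 s`, where `s ^ 2 = -2`, and exactly one of
these belongs to `squareTriples F`. -/
theorem odd_card_squareTriples_of_three_mod_eight (hF : ringChar F ≠ 2) (h3 : (3 : F) ≠ 0)
    (h : Fintype.card F % 8 = 3) : Odd #(squareTriples F) := by
  have h2 : (2 : F) ≠ 0 := Ring.two_ne_zero hF
  have c2 : quadraticChar F 2 = -1 := by rw [quadraticChar_two_eq hF, if_neg (by omega)]
  have cm1 : quadraticChar F (-1) = -1 := by rw [quadraticChar_neg_one_eq hF, if_neg (by omega)]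
  have cneg : ∀ a : F, quadraticChar F (-a) = -quadraticChar F a := fun a => by
    rw [← neg_one_mul, map_mul, cm1, neg_one_mul]
  have cm2 : quadraticChar F (-2) = 1 := by rw [cneg, c2, neg_neg]
  -- the square root of `-2` that is itself a square
  obtain ⟨s, hs2, hs⟩ : ∃ s : F, s ^ 2 = -2 ∧ quadraticChar F s = 1 := by
    obtain ⟨s, hs⟩ := (quadraticChar_one_iff_isSquare (neg_ne_zero.mpr h2)).mp cm2
    have hs0 : s ≠ 0 := by rintro rfl; simp [h2] at hs
    rcases quadraticChar_dichotomy hs0 with h | h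
    · exact ⟨s, by rw [hs, sq], h⟩
    · exact ⟨-s, by rw [hs]; ring, by rw [cneg, h, neg_neg]⟩
  have hs1 : s - 1 ≠ 0 := fun h => h3 (by linear_combination hs2 - (s + 1) * h)
  have hmem : 16 * s ∈ squareTriples F := by
    rw [mem_squareTriples]
    refine ⟨?_, ?_, ?_⟩
    · rw [show 16 * s = (2 ^ 2) ^ 2 * s by ring, quadraticChar_sq_mul (pow_ne_zero 2 h2), hs]
    · rw [show 16 * s + 8 = (2 * (s - 1)) ^ 2 * -2 by linear_combination 8 * hs2,
        quadraticChar_sq_mul (mul_ne_zero h2 hs1), cm2]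
    · rw [show 64 - 16 * s = (2 ^ 2 * (s - 1)) ^ 2 * s by
          linear_combination (-16 * s + 32) * hs2,
        quadraticChar_sq_mul (mul_ne_zero (pow_ne_zero 2 h2) hs1), hs]
  rw [← card_erase_add_one hmem, Nat.odd_add_one, Nat.not_odd_iff_even]
  have h16 : (16 : F) ≠ 0 := by
    rw [show (16 : F) = 2 ^ 4 by norm_num]; exact pow_ne_zero _ h2
  have h32 : (32 : F) ≠ 0 := by
    rw [show (32 : F) = 2 ^ 5 by norm_num]; exact pow_ne_zero _ h2
  have h512 : (512 : F) ≠ 0 := by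
    rw [show (512 : F) = 2 ^ 9 by norm_num]; exact pow_ne_zero _ h2
  refine even_card_of_involution_of_ne _ (fun w => -512 / w) ?_ ?_ ?_
  · intro w hw
    obtain ⟨hws, hw⟩ := mem_erase.mp hw
    obtain ⟨w0, w8, w64⟩ := ne_zero_of_mem_squareTriples hw
    obtain ⟨c0, c8, c64⟩ := mem_squareTriples.mp hw
    rw [mem_erase, mem_squareTriples]
    refine ⟨fun h => hws ?_, ?_, ?_, ?_⟩
    · rw [div_eq_iff w0] at h
      refine mul_left_cancel₀ h32 ?_
      linear_combination 16 * w * hs2 + s * h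
    · rw [show -512 / w = (16 / w) ^ 2 * (-2 * w) by field_simp; ring,
        quadraticChar_sq_mul (div_ne_zero h16 w0), map_mul, cm2, c0, one_mul]
    · rw [show -512 / w + 8 = (2 / w) ^ 2 * (-2 * (w * (64 - w))) by field_simp; ring,
        quadraticChar_sq_mul (div_ne_zero h2 w0), map_mul, map_mul, cm2, c0, c64, one_mul, one_mul]
    · rw [show 64 - -512 / w = ((2 ^ 3) / w) ^ 2 * (w * (w + 8)) by field_simp; ring,
        quadraticChar_sq_mul (div_ne_zero (pow_ne_zero 3 h2) w0), map_mul, c0, c8, one_mul]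
  · intro w hw
    have := (ne_zero_of_mem_squareTriples (mem_of_mem_erase hw)).1
    field_simp
  · intro w hw hfix
    obtain ⟨hws, hw⟩ := mem_erase.mp hw
    rw [div_eq_iff (ne_zero_of_mem_squareTriples hw).1] at hfix
    have : (w - 16 * s) * (w + 16 * s) = 0 := by linear_combination -hfix - 256 * hs2
    rcases mul_eq_zero.mp this with h | h
    · exact hws (sub_eq_zero.mp h)
    · have := (mem_squareTriples.mp hw).1
      rw [eq_neg_of_add_eq_zero_left h, cneg, (mem_squareTriples.mp hmem).1] at this
      exact absurd this (by decide)

/-- The involution `w ↦ 8 (64 - w) / (w + 8)` fixes only `16` and `-32`, and neither belongs to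
`squareTriples F`. -/
theorem even_card_squareTriples_of_seven_mod_eight (hF : ringChar F ≠ 2)
    (h3 : quadraticChar F 3 = -1) (h : Fintype.card F % 8 = 7) : Even #(squareTriples F) := by
  have h2 : (2 : F) ≠ 0 := Ring.two_ne_zero hF
  have h3' : (3 : F) ≠ 0 := fun h => by simp [h] at h3
  have c2 : quadraticChar F 2 = 1 := by rw [quadraticChar_two_eq hF, if_pos (by omega)]
  have cm1 : quadraticChar F (-1) = -1 := by rw [quadraticChar_neg_one_eq hF, if_neg (by omega)]
  have h576 : (576 : F) ≠ 0 := by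
    rw [show (576 : F) = 2 ^ 6 * 3 ^ 2 by norm_num]
    exact mul_ne_zero (pow_ne_zero _ h2) (pow_ne_zero _ h3')
  refine even_card_of_involution_of_ne _ (fun w => 8 * (64 - w) / (w + 8)) ?_ ?_ ?_
  · intro w hw
    obtain ⟨w0, w8, w64⟩ := ne_zero_of_mem_squareTriples hw
    obtain ⟨c0, c8, c64⟩ := mem_squareTriples.mp hw
    rw [mem_squareTriples]
    refine ⟨?_, ?_, ?_⟩
    · rw [show 8 * (64 - w) / (w + 8) = (2 / (w + 8)) ^ 2 * (2 * ((64 - w) * (w + 8))) by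
          field_simp; ring,
        quadraticChar_sq_mul (div_ne_zero h2 w8), map_mul, map_mul, c2, c8, c64, one_mul, one_mul]
    · rw [show 8 * (64 - w) / (w + 8) + 8 = ((2 ^ 3 * 3) / (w + 8)) ^ 2 * (w + 8) by
          field_simp; ring,
        quadraticChar_sq_mul
          (div_ne_zero (mul_ne_zero (pow_ne_zero 3 h2) h3') w8), c8]
    · rw [show 64 - 8 * (64 - w) / (w + 8) = ((2 * 3) / (w + 8)) ^ 2 * (2 * (w * (w + 8))) by
          field_simp; ring,
        quadraticChar_sq_mul (div_ne_zero (mul_ne_zero h2 h3') w8), map_mul, map_mul, c2, c0, c8,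
        one_mul, one_mul]
  · intro w hw
    have w8 := (ne_zero_of_mem_squareTriples hw).2.1
    have : 8 * (64 - w) / (w + 8) + 8 = 576 / (w + 8) := by field_simp; ring
    simp only [this]
    field_simp
    ring
  · intro w hw hfix
    rw [div_eq_iff (ne_zero_of_mem_squareTriples hw).2.1] at hfix
    have : (w - 16) * (w + 32) = 0 := by linear_combination -hfix
    obtain ⟨c0, c8, c64⟩ := mem_squareTriples.mp hw
    rcases mul_eq_zero.mp this with h | h
    · rw [sub_eq_zero.mp h, show (64 - 16 : F) = (2 ^ 2) ^ 2 * 3 by norm_num,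
        quadraticChar_sq_mul (pow_ne_zero 2 h2), h3] at c64
      exact absurd c64 (by decide)
    · rw [eq_neg_of_add_eq_zero_left h, show (-32 : F) = (2 ^ 2) ^ 2 * (-1 * 2) by norm_num,
        quadraticChar_sq_mul (pow_ne_zero 2 h2), map_mul, cm1, c2] at c0
      exact absurd c0 (by decide)

/-! ### Parity by a product over the nonsquares -/

/-- The sum of `1 - χ v` over all `v` is `q`; it counts the nonsquares twice and `0` once. -/
theorem card_nonsquares (hF : ringChar F ≠ 2) :
    #{v : F | quadraticChar F v = -1} = Fintype.card F / 2 := by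
  have hodd := FiniteField.odd_card_of_char_ne_two hF
  have key : ∀ v : F, 1 - quadraticChar F v =
      (if v = 0 then 1 else 0) + 2 * (if quadraticChar F v = -1 then 1 else 0) := by
    intro v
    by_cases hv : v = 0
    · simp [hv]
    · rcases quadraticChar_dichotomy hv with h | h <;> rw [h] <;> simp [hv]
  have hs := sum_congr rfl fun v (_ : v ∈ univ) => key v
  rw [sum_sub_distrib, quadraticChar_sum_zero hF, sum_add_distrib, ← mul_sum, sum_boole,
    sum_boole] at hs
  simp [filter_eq', -quadraticChar_apply] at hs
  omega

/-- Over a finite field of odd order `q`, the nonsquares are the roots of `X ^ ((q - 1) / 2) + 1`. -/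
theorem prod_X_sub_C_nonsquares (hF : ringChar F ≠ 2) :
    ∏ v : F with quadraticChar F v = -1, (X - C v) = (X ^ (Fintype.card F / 2) + 1 : F[X]) := by
  have hm : Fintype.card F / 2 ≠ 0 := by
    have := Fintype.one_lt_card (α := F)
    omega
  have hd : (∏ v : F with quadraticChar F v = -1, (X - C v)).degree =
      ((Fintype.card F / 2 : ℕ) : WithBot ℕ) := by
    rw [degree_prod]
    simp [card_nonsquares hF, -quadraticChar_apply]
  have hd' : (X ^ (Fintype.card F / 2) + 1 : F[X]).degree =
      ((Fintype.card F / 2 : ℕ) : WithBot ℕ) := by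
    rw [← C_1, degree_X_pow_add_C (Nat.pos_of_ne_zero hm)]
  refine eq_of_degree_sub_lt_of_eval_finset_eq {v : F | quadraticChar F v = -1} ?_ fun v hv => ?_
  · rw [card_nonsquares hF, ← hd]
    refine degree_sub_lt_left ?_ ?_ ?_
    · rw [hd, hd']
    · exact (monic_prod_X_sub_C _ _).ne_zero
    · rw [(monic_prod_X_sub_C _ _).leadingCoeff, ← C_1, leadingCoeff_X_pow_add_C
        (Nat.pos_of_ne_zero hm)]
  · have h := quadraticChar_eq_pow_of_char_ne_two' hF v
    rw [eval_prod, prod_eq_zero hv (by simp)]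
    rw [(mem_filter.mp hv).2] at h
    simp [← h]

/-- With `w = 2 (v - 1) ^ 2 / v`, the nonsquares `v` parametrize two to one the `w` for which `w`
and `w + 8` are nonzero squares, and `(64 - w) / 2 = 34 - v - 1 / v`. -/
theorem prod_nonsquares_eq_sq (hF : ringChar F ≠ 2) (h2 : quadraticChar F 2 = -1)
    (hm1 : quadraticChar F (-1) = 1) {M : Type*} [CommMonoid M] (f : F → M) :
    ∏ v : F with quadraticChar F v = -1, f (2 * (v - 1) ^ 2 / v) =
      (∏ w : F with quadraticChar F w = 1 ∧ quadraticChar F (w + 8) = 1, f w) ^ 2 := by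
  have h2' : (2 : F) ≠ 0 := Ring.two_ne_zero hF
  rw [← prod_pow, ← prod_fiberwise_of_maps_to (g := fun v => 2 * (v - 1) ^ 2 / v)
    (t := {w : F | quadraticChar F w = 1 ∧ quadraticChar F (w + 8) = 1})]
  · refine prod_congr rfl fun w hw => ?_
    obtain ⟨c0, c8⟩ := (mem_filter.mp hw).2
    have w0 : w ≠ 0 := fun h => by simp [h] at c0
    have w8 : w + 8 ≠ 0 := fun h => by simp [h] at c8
    obtain ⟨r, hr⟩ := (quadraticChar_one_iff_isSquare w0).mp c0
    obtain ⟨s, hs⟩ := (quadraticChar_one_iff_isSquare w8).mp c8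
    have r0 : r ≠ 0 := by rintro rfl; simp at hr; exact w0 hr
    have s0 : s ≠ 0 := by rintro rfl; simp at hs; exact w8 hs
    have h4 : (4 : F) ≠ 0 := by
      rw [show (4 : F) = 2 ^ 2 by norm_num]; exact pow_ne_zero _ h2'
    have hset : (({v : F | quadraticChar F v = -1} : Finset F).filter
        fun v => 2 * (v - 1) ^ 2 / v = w) = {(4 + w + r * s) / 4, (4 + w - r * s) / 4} := by
      ext v
      simp only [mem_filter, mem_univ, true_and, mem_insert, mem_singleton]
      constructor
      · rintro ⟨hv, h⟩
        have v0 : v ≠ 0 := fun h => by simp [h] at hv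
        rw [div_eq_iff v0] at h
        have : (4 * v - (4 + w + r * s)) * (4 * v - (4 + w - r * s)) = 0 := by
          linear_combination 8 * h + (w + 8) * hr + r * r * hs
        rcases mul_eq_zero.mp this with h | h
        · left; rw [eq_div_iff h4]; linear_combination h
        · right; rw [eq_div_iff h4]; linear_combination h
      · intro h
        have h : 2 * (v - 1) ^ 2 = w * v := by
          have : (4 * v - (4 + w + r * s)) * (4 * v - (4 + w - r * s)) = 0 := by
            rcases h with h | h <;> rw [eq_div_iff h4] at h <;> rw [← h] <;> ring
          have h8 : (8 : F) ≠ 0 := by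
            rw [show (8 : F) = 2 ^ 3 by norm_num]; exact pow_ne_zero _ h2'
          refine mul_left_cancel₀ h8 ?_
          linear_combination this - (w + 8) * hr - r * r * hs
        have v0 : v ≠ 0 := by
          rintro rfl
          simp [h2'] at h
        have v1 : v - 1 ≠ 0 := by
          intro h1
          rw [h1] at h
          simp [w0, v0] at h
        refine ⟨?_, by rw [div_eq_iff v0, h]⟩
        have := quadraticChar_sq_mul v1 2
        rw [mul_comm, h, map_mul, c0, one_mul, h2] at this
        exact this
    rw [hset]
    have hne : (4 + w + r * s) / 4 ≠ (4 + w - r * s) / 4 := by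
      intro h
      have : 2 * (r * s) = 0 := by
        field_simp at h
        linear_combination h
      simp [h2', r0, s0] at this
    rw [prod_congr rfl (g := fun _ => f w), prod_const, card_pair hne]
    intro v hv
    rw [← hset] at hv
    rw [(mem_filter.mp hv).2]
  · intro v hv
    have hv := (mem_filter.mp hv).2
    have v0 : v ≠ 0 := fun h => by simp [h] at hv
    have v1 : v - 1 ≠ 0 := fun h => by
      rw [sub_eq_zero.mp h] at hv; simp at hv
    have v1' : v + 1 ≠ 0 := fun h => by
      rw [eq_neg_of_add_eq_zero_left h, hm1] at hv
      exact absurd hv (by decide)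
    rw [mem_filter]
    refine ⟨mem_univ _, ?_, ?_⟩
    · rw [show 2 * (v - 1) ^ 2 / v = ((v - 1) / v) ^ 2 * (2 * v) by field_simp,
        quadraticChar_sq_mul (div_ne_zero v1 v0), map_mul, h2, hv]; norm_num
    · rw [show 2 * (v - 1) ^ 2 / v + 8 = ((v + 1) / v) ^ 2 * (2 * v) by field_simp; ring,
        quadraticChar_sq_mul (div_ne_zero v1' v0), map_mul, h2, hv]; norm_num

/-- The product of `34 - v - 1 / v = (β - v) (β⁻¹ - v) / (-v)` over the nonsquares `v`, where
`β = (1 + √2) ^ 4`, is `(β ^ m + 1) (β⁻¹ ^ m + 1)` with `m = (q - 1) / 2`, and the Frobenius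
conjugates `√2`, so that `β ^ m = (1 + √2) ^ (2 (q - 1)) = β⁻¹`. -/
theorem prod_nonsquares_eq (hF : ringChar F ≠ 2) (h2 : quadraticChar F 2 = -1)
    {K : Type*} [Field K] [Algebra F K] {r : K} (hr : r ^ 2 = 2) :
    ∏ v : F with quadraticChar F v = -1, (64 - 2 * (v - 1) ^ 2 / v) / 2 = 36 := by
  have h2' : (2 : F) ≠ 0 := Ring.two_ne_zero hF
  have hodd := FiniteField.odd_card_of_char_ne_two hF
  set m := Fintype.card F / 2 with hm
  have hq : Fintype.card F = 2 * m + 1 := by omega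
  have hm0 : m ≠ 0 := by
    have := Fintype.one_lt_card (α := F)
    omega
  have hprod : ∀ b : K, ∏ v : F with quadraticChar F v = -1, (b - algebraMap F K v) = b ^ m + 1 := by
    intro b
    have := congrArg (aeval b) (prod_X_sub_C_nonsquares hF)
    simpa [map_prod] using this
  have h2m : (2 : K) ^ m = -1 := by
    have := quadraticChar_eq_pow_of_char_ne_two' hF (2 : F)
    rw [h2] at this
    rw [← map_ofNat (algebraMap F K), ← map_pow, ← this]
    simp
  have hr' : r ^ Fintype.card F = -r := by
    rw [hq, pow_succ, pow_mul, hr, h2m]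
    ring
  have hfrob : (1 + r) ^ Fintype.card F = 1 - r := by
    have := map_add (FiniteField.frobeniusAlgHom F K) 1 r
    simp only [FiniteField.coe_frobeniusAlgHom, one_pow, hr'] at this
    rw [this]
    ring
  have hfrob' : (1 - r) ^ Fintype.card F = 1 + r := by
    have := map_sub (FiniteField.frobeniusAlgHom F K) 1 r
    simp only [FiniteField.coe_frobeniusAlgHom, one_pow, hr'] at this
    rw [this]
    ring
  have hε : (1 + r) * (1 - r) = -1 := by linear_combination -hr
  have hβ : (17 + 12 * r) ^ m = 17 - 12 * r := by
    have h1 : (1 + r) ^ (2 * m) = -(1 - r) ^ 2 := by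
      rw [hq, pow_succ] at hfrob
      linear_combination -(1 - r) * hfrob + (1 + r) ^ (2 * m) * hε
    rw [show 17 + 12 * r = ((1 + r) ^ 2) ^ 2 by
      linear_combination (-r ^ 2 - 4 * r - 8) * hr, ← pow_mul, ← pow_mul,
      show 2 * (2 * m) = 2 * m * 2 by ring, pow_mul, h1]
    linear_combination (r ^ 2 - 4 * r + 8) * hr
  have hβ' : (17 - 12 * r) ^ m = 17 + 12 * r := by
    have h1 : (1 - r) ^ (2 * m) = -(1 + r) ^ 2 := by
      rw [hq, pow_succ] at hfrob'
      linear_combination -(1 + r) * hfrob' + (1 - r) ^ (2 * m) * hε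
    rw [show 17 - 12 * r = ((1 - r) ^ 2) ^ 2 by
      linear_combination (-r ^ 2 + 4 * r - 8) * hr, ← pow_mul, ← pow_mul,
      show 2 * (2 * m) = 2 * m * 2 by ring, pow_mul, h1]
    linear_combination (r ^ 2 + 4 * r + 8) * hr
  apply (algebraMap F K).injective
  have hterm : ∀ v ∈ ({v : F | quadraticChar F v = -1} : Finset F),
      algebraMap F K ((64 - 2 * (v - 1) ^ 2 / v) / 2) =
        ((17 + 12 * r) - algebraMap F K v) * ((17 - 12 * r) - algebraMap F K v) *
          (0 - algebraMap F K v)⁻¹ := by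
    intro v hv
    have v0 : v ≠ 0 := fun h => by simp [h] at hv
    have v0' : algebraMap F K v ≠ 0 := by simpa using v0
    rw [show (64 - 2 * (v - 1) ^ 2 / v) / 2 = (v ^ 2 - 34 * v + 1) * (0 - v)⁻¹ by
      field_simp; ring]
    simp only [map_mul, map_inv₀, map_sub, map_add, map_pow, map_one, map_zero, map_ofNat]
    congr 1
    linear_combination 144 * hr
  rw [map_prod, prod_congr rfl hterm, prod_mul_distrib, prod_mul_distrib, prod_inv_distrib, hprod,
    hprod, hprod, hβ, hβ', zero_pow hm0, map_ofNat]
  linear_combination -144 * hr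

/-- The product of the `(64 - w) / 2` over all `w` for which `w` and `w + 8` are nonzero squares is
`±6`, which decides the parity of the number of those `w` for which `64 - w` is a square. -/
theorem odd_card_squareTriples_of_five_mod_eight (hF : ringChar F ≠ 2)
    (h3 : quadraticChar F 3 = 1) (h : Fintype.card F % 8 = 5) : Odd #(squareTriples F) := by
  have h2 : (2 : F) ≠ 0 := Ring.two_ne_zero hF
  have h3' : (3 : F) ≠ 0 := fun h => by simp [h] at h3
  have c2 : quadraticChar F 2 = -1 := by rw [quadraticChar_two_eq hF, if_neg (by omega)]
  have cm1 : quadraticChar F (-1) = 1 := by rw [quadraticChar_neg_one_eq hF, if_pos (by omega)]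
  set T : Finset F := {w : F | quadraticChar F w = 1 ∧ quadraticChar F (w + 8) = 1} with hT
  have hcard : #T * 2 = Fintype.card F / 2 := by
    have := prod_nonsquares_eq_sq hF c2 cm1 (fun _ => 2)
    rw [prod_const, prod_const, card_nonsquares hF, ← pow_mul] at this
    exact (Nat.pow_right_injective le_rfl this).symm
  have hQ := prod_nonsquares_eq_sq hF c2 cm1 (fun w => (64 - w) / 2)
  obtain ⟨r, hr⟩ := IsAlgClosed.exists_pow_nat_eq (2 : AlgebraicClosure F) two_pos
  rw [prod_nonsquares_eq hF c2 hr] at hQ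
  have hQ' : quadraticChar F (∏ w ∈ T, (64 - w) / 2) = -1 := by
    have c6 : quadraticChar F 6 = -1 := by
      rw [show (6 : F) = 2 * 3 by norm_num, map_mul, c2, h3]; norm_num
    have : ((∏ w ∈ T, (64 - w) / 2) - 6) * ((∏ w ∈ T, (64 - w) / 2) + 6) = 0 := by
      linear_combination -hQ
    rcases mul_eq_zero.mp this with h | h
    · rw [sub_eq_zero.mp h, c6]
    · rw [eq_neg_of_add_eq_zero_left h, ← neg_one_mul, map_mul, cm1, c6, one_mul]
  have hterm : ∀ w ∈ T, quadraticChar F ((64 - w) / 2) =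
      if quadraticChar F (64 - w) = 1 then -1 else 1 := by
    intro w hw
    have w64 : 64 - w ≠ 0 := by
      intro h
      have c8 := (mem_filter.mp hw).2.2
      rw [← sub_eq_zero.mp h, show (64 + 8 : F) = (2 * 3) ^ 2 * 2 by norm_num,
        quadraticChar_sq_mul (mul_ne_zero h2 h3'), c2] at c8
      exact absurd c8 (by decide)
    rw [show (64 - w) / 2 = (2⁻¹) ^ 2 * (2 * (64 - w)) by field_simp,
      quadraticChar_sq_mul (inv_ne_zero h2), map_mul, c2]
    rcases quadraticChar_dichotomy w64 with h | h <;> rw [h] <;> norm_num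
  rw [map_prod, prod_congr rfl hterm, prod_ite, prod_const, prod_const_one, mul_one,
    neg_one_pow_eq_neg_one_iff_odd (by decide)] at hQ'
  convert hQ' using 2
  ext w
  simp [mem_squareTriples, hT, and_assoc]

/-! ### Nonvanishing of the character sum -/

/-- Quadratic reciprocity for `3`, when `q ≡ 1 [MOD 3]`. -/
theorem quadraticChar_three_eq (hF : ringChar F ≠ 2) (h3 : ringChar F ≠ 3)
    (h : Fintype.card F % 3 = 1) :
    quadraticChar F 3 = if Fintype.card F % 4 = 1 then 1 else -1 := by
  have hodd := FiniteField.odd_card_of_char_ne_two hF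
  have := quadraticChar_odd_prime hF (p := 3) (by decide) h3
  rw [Nat.cast_ofNat] at this
  rw [this, ZMod.χ₄_nat_eq_if_mod_four, if_neg (by omega),
    show (Fintype.card F : ZMod 3) = 1 by
      rw [← ZMod.natCast_mod, h, Nat.cast_one]]
  split_ifs <;> decide

/-- For `q ≡ 3 [MOD 8]` the contributions of the two square roots `±r` of `-8` cancel, because
`χ (r - 8) χ (-r - 8) = χ 72 = -1`; for `q ≡ 5, 7 [MOD 8]` there are no such roots. -/
theorem sqrtSum_neg_eight_eq_zero (hF : ringChar F ≠ 2) (h3 : (3 : F) ≠ 0)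
    (h : Fintype.card F % 8 ≠ 1) : sqrtSum F (-8) = 0 := by
  have hodd := FiniteField.odd_card_of_char_ne_two hF
  have h2 : (2 : F) ≠ 0 := Ring.two_ne_zero hF
  have c2 := quadraticChar_two_eq hF
  have cm1 := quadraticChar_neg_one_eq hF
  have c8 : quadraticChar F (-8) = quadraticChar F (-1) * quadraticChar F 2 := by
    rw [show (-8 : F) = 2 ^ 2 * (-1 * 2) by norm_num, quadraticChar_sq_mul h2, map_mul]
  by_cases h8 : Fintype.card F % 8 = 3
  · rw [if_neg (by omega)] at c2 cm1
    rw [c2, cm1] at c8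
    have n8 : (-8 : F) ≠ 0 := fun h => by simp [h] at c8
    obtain ⟨r, hr⟩ := (quadraticChar_one_iff_isSquare n8).mp c8
    have r0 : r ≠ 0 := by rintro rfl; simp at hr; simp [hr] at n8
    rw [hr, ← sq, sqrtSum_sq hF r0]
    have hprod : quadraticChar F (r - 8) * quadraticChar F (-r - 8) = -1 := by
      rw [← map_mul, show (r - 8) * (-r - 8) = (2 * 3) ^ 2 * 2 by linear_combination hr,
        quadraticChar_sq_mul (mul_ne_zero h2 h3), c2]
    have n1 : r - 8 ≠ 0 := fun h => by simp [h] at hprod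
    have n2 : -r - 8 ≠ 0 := fun h => by simp [h] at hprod
    rcases quadraticChar_dichotomy n1 with a | a <;>
      rcases quadraticChar_dichotomy n2 with b | b <;> rw [a, b] at hprod ⊢ <;> omega
  · refine sqrtSum_of_not_isSquare ?_
    rw [c8, c2, cm1]
    split_ifs <;> omega

theorem sqrtSum_neg_eight_modEq (hF : ringChar F ≠ 2) (h3 : (3 : F) ≠ 0)
    (h : Fintype.card F % 8 = 1) : sqrtSum F (-8) ≡ 2 [ZMOD 4] := by
  have h2 : (2 : F) ≠ 0 := Ring.two_ne_zero hF
  have c2 : quadraticChar F 2 = 1 := by rw [quadraticChar_two_eq hF, if_pos (by omega)]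
  have cm1 : quadraticChar F (-1) = 1 := by rw [quadraticChar_neg_one_eq hF, if_pos (by omega)]
  have c72 : quadraticChar F 72 = 1 := by
    rw [show (72 : F) = (2 * 3) ^ 2 * 2 by norm_num, quadraticChar_sq_mul (mul_ne_zero h2 h3), c2]
  have := sqrtSum_modEq hF (w := -8) (by
    rw [show (-8 : F) = 2 ^ 2 * (-1 * 2) by norm_num, quadraticChar_sq_mul h2, map_mul, c2, cm1,
      one_mul]) (fun h => by
    rw [show (72 : F) = 64 - (-8) by norm_num, h, sub_self] at c72
    simp at c72)
  rwa [show (64 - -8 : F) = 72 by norm_num, c72] at this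

/-- If the character sum of `y² = x³ - 8x² - 2x` vanishes, then `q ≡ 5, 23 [MOD 24]`: for all other
`q` coprime to `6` the sum is `2` modulo `4` or `4` modulo `8`. -/
theorem card_mod_of_sum_eq_zero (hF : ringChar F ≠ 2) (hF3 : ringChar F ≠ 3)
    (hq3 : Fintype.card F % 3 ≠ 0)
    (hS : ∑ x : F, quadraticChar F (x ^ 3 - 8 * x ^ 2 - 2 * x) = 0) :
    Fintype.card F % 24 = 5 ∨ Fintype.card F % 24 = 23 := by
  have hodd := FiniteField.odd_card_of_char_ne_two hF
  have h3 : (3 : F) ≠ 0 := by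
    intro h
    have := (ringChar.spec F 3).mp (by exact_mod_cast h)
    rcases (Nat.dvd_prime Nat.prime_three).mp this with h1 | h1
    · exact CharP.ringChar_ne_one h1
    · exact hF3 h1
  have hmod := sum_modEq_card_squareTriples hF h3
  have c2 := quadraticChar_two_eq hF
  have cm1 := quadraticChar_neg_one_eq hF
  rw [hS, show (-2 : F) = -1 * 2 by norm_num, map_mul] at hmod
  by_contra! hcon
  have hcases : Fintype.card F % 8 = 1 ∨ Fintype.card F % 8 = 3 ∨
      (Fintype.card F % 8 = 5 ∧ Fintype.card F % 3 = 1) ∨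
      (Fintype.card F % 8 = 7 ∧ Fintype.card F % 3 = 1) := by omega
  rcases hcases with h | h | ⟨h, h'⟩ | ⟨h, h'⟩
  · have := sqrtSum_neg_eight_modEq hF h3 h
    rw [if_pos (by omega)] at c2 cm1
    rw [c2, cm1] at hmod
    simp only [Int.ModEq] at hmod this
    omega
  all_goals rw [sqrtSum_neg_eight_eq_zero hF h3 (by omega)] at hmod
  · obtain ⟨k, hk⟩ := odd_card_squareTriples_of_three_mod_eight hF h3 h
    rw [if_neg (by omega)] at c2 cm1
    rw [c2, cm1, hk] at hmod
    simp [Int.ModEq] at hmod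
    omega
  · have c3 := quadraticChar_three_eq hF hF3 h'
    rw [if_pos (by omega)] at c3 cm1
    obtain ⟨k, hk⟩ := odd_card_squareTriples_of_five_mod_eight hF c3 h
    rw [if_neg (by omega)] at c2
    rw [c2, cm1, hk] at hmod
    simp [Int.ModEq] at hmod
    omega
  · have c3 := quadraticChar_three_eq hF hF3 h'
    rw [if_neg (by omega)] at c3 cm1
    obtain ⟨k, hk⟩ := even_card_squareTriples_of_seven_mod_eight hF c3 h
    rw [if_pos (by omega)] at c2
    rw [c2, cm1, hk] at hmod
    simp [Int.ModEq] at hmod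
    omega

end CharacterSums

/-! ### The Hasse invariant -/

theorem FiniteField.sum_pow_of_lt_two_mul_card_sub_one {K : Type*} [Field K] [Fintype K] {i : ℕ}
    (h : i < 2 * (Fintype.card K - 1)) :
    ∑ x : K, x ^ i = if i = Fintype.card K - 1 then -1 else 0 := by
  classical
  have hq := Fintype.one_lt_card (α := K)
  rcases lt_trichotomy i (Fintype.card K - 1) with hi | hi | hi
  · rw [if_neg hi.ne, sum_pow_lt_card_sub_one K i hi]
  · have : ∀ x : K, x ^ i = 1 - if x = 0 then 1 else 0 := by
      intro x
      split_ifs with hx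
      · rw [hx, zero_pow (by omega), sub_self]
      · rw [hi, pow_card_sub_one_eq_one x hx, sub_zero]
    rw [if_pos hi, sum_congr rfl fun x _ => this x]
    simp
  · rw [if_neg hi.ne', ← sum_pow_lt_card_sub_one K (i - (Fintype.card K - 1)) (by omega)]
    refine sum_congr rfl fun x _ => ?_
    by_cases hx : x = 0
    · rw [hx, zero_pow (by omega), zero_pow (by omega)]
    · conv_lhs => rw [← Nat.sub_add_cancel hi.le, pow_add, pow_card_sub_one_eq_one x hx, mul_one]

theorem FiniteField.sum_eval_eq_neg_coeff {K : Type*} [Field K] [Fintype K] {g : K[X]}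
    (hg : g.natDegree < 2 * (Fintype.card K - 1)) :
    ∑ x : K, g.eval x = -g.coeff (Fintype.card K - 1) := by
  have hq := Fintype.one_lt_card (α := K)
  simp_rw [eval_eq_sum_range' hg]
  rw [sum_comm, sum_congr rfl (g := fun i => if i = Fintype.card K - 1 then
    -g.coeff (Fintype.card K - 1) else 0)]
  · rw [sum_ite_eq', if_pos (by rw [mem_range]; omega)]
  · intro i hi
    rw [← mul_sum, sum_pow_of_lt_two_mul_card_sub_one (mem_range.mp hi)]
    split_ifs with h
    · rw [h, mul_neg_one]
    · rw [mul_zero]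

/-- If `h` has degree less than `2q - 1`, then only its coefficient of index `q - 1` contributes to
the coefficients of `h(X) g(X ^ q)` whose index is congruent to `-1` modulo `q`. -/
theorem Polynomial.coeff_mul_expand_of_natDegree_lt {R : Type*} [CommRing R] {q : ℕ} (hq : 0 < q)
    {h : R[X]} (hh : h.natDegree < 2 * q - 1) (g : R[X]) (M : ℕ) :
    (h * expand R q g).coeff (q - 1 + q * M) = h.coeff (q - 1) * g.coeff M := by
  rw [coeff_mul, sum_eq_single (q - 1, q * M), coeff_expand_mul' hq]
  · rintro ⟨i, j⟩ hij hne
    rw [HasAntidiagonal.mem_antidiagonal] at hij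
    dsimp only at hij ⊢
    rw [coeff_expand hq]
    split_ifs with hd
    · obtain ⟨l, rfl⟩ := hd
      have hl : l ≤ M := by
        by_contra! hl
        have := Nat.mul_le_mul_left q (Nat.succ_le_of_lt hl)
        rw [Nat.succ_eq_add_one, mul_add, mul_one] at this
        omega
      obtain ⟨d, rfl⟩ := Nat.exists_eq_add_of_le hl
      have hi : i = q - 1 + q * d := by
        rw [mul_add] at hij
        omega
      -- `d = 0` is the excepted index, and for `d ≥ 1` the index `i` exceeds the degree of `h`
      rcases Nat.eq_zero_or_pos d with rfl | hd
      · exact absurd (by simp [hi]) hne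
      · have := Nat.mul_le_mul_left q (Nat.succ_le_of_lt hd)
        rw [coeff_eq_zero_of_natDegree_lt (by omega), zero_mul]
    · rw [mul_zero]
  · exact fun h => absurd (by rw [HasAntidiagonal.mem_antidiagonal]) h

/-- With `q` the cardinality of `k` and `h = f ^ ((q - 1) / 2)`, the power `(q ^ (n + 1) - 1) / 2` of
`f` is `h` times the `q`-th power of `f ^ ((q ^ n - 1) / 2)`, and that `q`-th power is an expansion
because the coefficients lie in `k`. -/
theorem coeff_pow_card_pow {k : Type*} [Field k] [Fintype k] (hk : ringChar k ≠ 2) {f : k[X]}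
    (hf : f.natDegree ≤ 3) (n : ℕ) :
    (f ^ (Fintype.card k ^ n / 2)).coeff (Fintype.card k ^ n - 1) =
      (f ^ (Fintype.card k / 2)).coeff (Fintype.card k - 1) ^ n := by
  have hodd := FiniteField.odd_card_of_char_ne_two hk
  have hq1 := Fintype.one_lt_card (α := k)
  set q := Fintype.card k with hq
  induction n with
  | zero => simp
  | succ n ih =>
    obtain ⟨a, ha⟩ : Odd q := Nat.odd_iff.mpr hodd
    obtain ⟨b, hb⟩ : Odd (q ^ n) := (Nat.odd_iff.mpr hodd).pow
    have h1 : q ^ (n + 1) / 2 = q / 2 + (q ^ n / 2) * q := by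
      rw [pow_succ, hb, show (2 * b + 1) / 2 = b by omega]
      have : (2 * b + 1) * q = 2 * (b * q) + q := by ring
      omega
    have h2 : q ^ (n + 1) - 1 = q - 1 + q * (q ^ n - 1) := by
      rw [pow_succ, hb, Nat.add_sub_cancel]
      have : (2 * b + 1) * q = q * (2 * b) + q := by ring
      omega
    have hdeg : (f ^ (q / 2)).natDegree < 2 * q - 1 := by
      refine natDegree_pow_le.trans_lt ?_
      have := Nat.mul_le_mul_left (q / 2) hf
      omega
    rw [h1, h2, pow_add, pow_mul, ← FiniteField.expand_card, ← hq,
      coeff_mul_expand_of_natDegree_lt (by omega) hdeg, ih, pow_succ']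

namespace WeierstrassCurve

theorem eval_twoTorsionPolynomial {R : Type*} [CommRing R] (W : WeierstrassCurve R) (x : R) :
    W.twoTorsionPolynomial.toPoly.eval x = 4 * x ^ 3 + W.b₂ * x ^ 2 + 2 * W.b₄ * x + W.b₆ := by
  simp [twoTorsionPolynomial, Cubic.toPoly]

/-- Completing the square turns the points above `x` into the square roots of the value of the
two-torsion polynomial at `x`. -/
theorem card_point {K : Type*} [Field K] [Fintype K] [DecidableEq K] (hK : ringChar K ≠ 2)
    (W : WeierstrassCurve K) [W.IsElliptic] :
    (Nat.card W.toAffine.Point : ℤ) =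
      1 + ∑ x : K, (1 + quadraticChar K (W.twoTorsionPolynomial.toPoly.eval x)) := by
  classical
  have h2 : (2 : K) ≠ 0 := Ring.two_ne_zero hK
  have h4 : (4 : K) ≠ 0 := by
    rw [show (4 : K) = 2 ^ 2 by norm_num]; exact pow_ne_zero _ h2
  have hfib : ∀ x : K, (#{y : K | W.toAffine.Equation x y} : ℤ) =
      1 + quadraticChar K (W.twoTorsionPolynomial.toPoly.eval x) := by
    intro x
    rw [add_comm, ← quadraticChar_card_sqrts hK, Nat.cast_inj]
    refine card_bij' (fun y _ => 2 * y + W.a₁ * x + W.a₃)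
      (fun z _ => (z - W.a₁ * x - W.a₃) / 2) ?_ ?_ ?_ ?_
    · intro y hy
      rw [mem_filter, Affine.equation_iff] at hy
      rw [Set.mem_toFinset, Set.mem_ofPred_eq, eval_twoTorsionPolynomial, b₂, b₄, b₆]
      linear_combination 4 * hy.2
    · intro z hz
      rw [Set.mem_toFinset, Set.mem_ofPred_eq, eval_twoTorsionPolynomial, b₂, b₄, b₆] at hz
      rw [mem_filter, Affine.equation_iff]
      refine ⟨mem_univ _, ?_⟩
      refine mul_left_cancel₀ h4 ?_
      field_simp
      linear_combination hz
    · intro y _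
      field_simp
      ring
    · intro z _
      field_simp
      ring
  simp_rw [← hfib]
  have hcard : Nat.card (WithZero {xy : K × K // W.toAffine.Equation xy.1 xy.2}) =
      Nat.card {xy : K × K // W.toAffine.Equation xy.1 xy.2} + 1 := Finite.card_option
  rw [Nat.card_congr (Affine.pointEquiv W.toAffine), hcard,
    Nat.card_congr (Equiv.subtypeProdEquivSigmaSubtype fun x y => W.toAffine.Equation x y),
    Nat.card_sigma, add_comm, Nat.cast_add, Nat.cast_one, Nat.cast_sum]
  simp_rw [Nat.card_eq_fintype_card, Fintype.card_subtype]

theorem natDegree_twoTorsionPolynomial_le {R : Type*} [CommRing R] (W : WeierstrassCurve R) :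
    W.twoTorsionPolynomial.toPoly.natDegree ≤ 3 :=
  natDegree_cubic_le

/-- The Hasse invariant of `W` over a field with `q` elements, `q` odd: the coefficient of
`x ^ (q - 1)` in the power `(q - 1) / 2` of the two-torsion polynomial, where `(q - 1) / 2` is
written as the natural number quotient `q / 2`. -/
noncomputable def hasseCoeff {k : Type*} [Field k] [Fintype k] (W : WeierstrassCurve k) : k :=
  (W.twoTorsionPolynomial.toPoly ^ (Fintype.card k / 2)).coeff (Fintype.card k - 1)

theorem sum_quadraticChar_eq_neg_hasseCoeff {k : Type*} [Field k] [Fintype k] [DecidableEq k]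
    (hk : ringChar k ≠ 2) (W : WeierstrassCurve k) :
    ((∑ x : k, quadraticChar k (W.twoTorsionPolynomial.toPoly.eval x) : ℤ) : k) =
      -W.hasseCoeff := by
  have hq := Fintype.one_lt_card (α := k)
  have hodd := FiniteField.odd_card_of_char_ne_two hk
  have hdeg : (W.twoTorsionPolynomial.toPoly ^ (Fintype.card k / 2)).natDegree <
      2 * (Fintype.card k - 1) := by
    refine natDegree_pow_le.trans_lt ?_
    have := Nat.mul_le_mul_left (Fintype.card k / 2) W.natDegree_twoTorsionPolynomial_le
    omega
  rw [hasseCoeff, ← FiniteField.sum_eval_eq_neg_coeff hdeg, Int.cast_sum]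
  refine sum_congr rfl fun x _ => ?_
  rw [quadraticChar_eq_pow_of_char_ne_two' hk, eval_pow]

theorem hasseCoeff_map {k K : Type*} [Field k] [Fintype k] [Field K] [Fintype K]
    (hk : ringChar k ≠ 2) (W : WeierstrassCurve k) (f : k →+* K) {n : ℕ}
    (hn : Fintype.card K = Fintype.card k ^ n) : (W.map f).hasseCoeff = f (W.hasseCoeff ^ n) := by
  have h : (W.map f).twoTorsionPolynomial.toPoly = W.twoTorsionPolynomial.toPoly.map f := by
    simp only [twoTorsionPolynomial, map_b₂, map_b₄, map_b₆, ← Cubic.map_toPoly, Cubic.map,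
      map_mul, map_ofNat]
  rw [hasseCoeff, hasseCoeff, h, ← Polynomial.map_pow, coeff_map, hn,
    coeff_pow_card_pow hk W.natDegree_twoTorsionPolynomial_le]

theorem natCast_card_point {K : Type*} [Field K] [Fintype K] (hK : ringChar K ≠ 2)
    (W : WeierstrassCurve K) [W.IsElliptic] :
    (Nat.card W.toAffine.Point : K) = 1 - W.hasseCoeff := by
  classical
  have := congrArg (Int.cast : ℤ → K) (card_point hK W)
  rw [sum_add_distrib, Int.cast_add, Int.cast_add, sum_quadraticChar_eq_neg_hasseCoeff hK] at this
  simpa [FiniteField.cast_card_eq_zero, sub_eq_add_neg] using this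

/-- If the Hasse invariant is nonzero, then over the extension of degree `q - 1` the number of
points is divisible by the characteristic, and Cauchy's theorem gives a point of order `p`. -/
theorem IsSupersingular.hasseCoeff_eq_zero {k : Type*} [Field k] [Fintype k] (hk : ringChar k ≠ 2)
    {W : WeierstrassCurve k} (hW : W.IsSupersingular) : W.hasseCoeff = 0 := by
  classical
  by_contra hA
  obtain ⟨hell, htors⟩ := hW
  have hq := Fintype.one_lt_card (α := k)
  have : CharP k (ringChar k) := ringChar.charP k
  have hp : Fact (ringChar k).Prime := ⟨CharP.char_is_prime k _⟩
  have : NeZero (Fintype.card k - 1) := ⟨by omega⟩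
  let K := FiniteField.Extension k (ringChar k) (Fintype.card k - 1)
  have : Fintype K := Fintype.ofFinite K
  have : CharP K (ringChar k) := charP_of_injective_algebraMap (algebraMap k K).injective _
  have hcard : Fintype.card K = Fintype.card k ^ (Fintype.card k - 1) := by
    rw [← Nat.card_eq_fintype_card, FiniteField.natCard_extension, Nat.card_eq_fintype_card]
  have hK : ringChar K ≠ 2 := by rwa [ringChar.eq K (ringChar k)]
  have : (W.baseChange K).IsElliptic := inferInstanceAs (W.map (algebraMap k K)).IsElliptic
  have hcardW : (Nat.card (W.baseChange K).toAffine.Point : K) = 0 := by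
    rw [natCast_card_point hK, baseChange, hasseCoeff_map hk W (algebraMap k K) hcard,
      FiniteField.pow_card_sub_one_eq_one _ hA, map_one, sub_self]
  rw [CharP.cast_eq_zero_iff K (ringChar k)] at hcardW
  have : Finite (WithZero {xy : K × K // (W.baseChange K).toAffine.Equation xy.1 xy.2}) :=
    inferInstanceAs (Finite (Option _))
  have : Finite (W.baseChange K).toAffine.Point :=
    Finite.of_equiv _ (Affine.pointEquiv (W.baseChange K).toAffine).symm
  obtain ⟨P, hP⟩ := exists_prime_addOrderOf_dvd_card' (ringChar k) hcardW
  let f : K →ₐ[k] AlgebraicClosure k := IsAlgClosed.lift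
  have hP0 : Affine.Point.map (W' := W) f P = 0 := by
    refine htors _ ?_
    rw [← map_nsmul, addOrderOf_dvd_iff_nsmul_eq_zero.mp hP.dvd, _root_.map_zero]
  rw [← _root_.map_zero (Affine.Point.map (W' := W) f)] at hP0
  rw [Affine.Point.map_injective f hP0, addOrderOf_zero] at hP
  exact hp.out.one_lt.ne hP

end WeierstrassCurve

/-! ### Reduction of the curve -/

/-- The term at `x = 0` vanishes, so the sum is smaller than `p` in absolute value. -/
theorem sum_quadraticChar_eq_zero_of_intCast_eq_zero {k : Type*} [Field k] [Fintype k] [DecidableEq k]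
    (hk : Fintype.card k = ringChar k)
    (h : ((∑ x : k, quadraticChar k (x ^ 3 - 8 * x ^ 2 - 2 * x) : ℤ) : k) = 0) :
    ∑ x : k, quadraticChar k (x ^ 3 - 8 * x ^ 2 - 2 * x) = 0 := by
  have : CharP k (ringChar k) := ringChar.charP k
  rw [CharP.intCast_eq_zero_iff k (ringChar k), ← hk] at h
  refine Int.eq_zero_of_abs_lt_dvd h ?_
  calc |∑ x : k, quadraticChar k (x ^ 3 - 8 * x ^ 2 - 2 * x)|
      ≤ ∑ x : k, |quadraticChar k (x ^ 3 - 8 * x ^ 2 - 2 * x)| := abs_sum_le_sum_abs _ _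
    _ < ∑ _x : k, (1 : ℤ) := by
        refine sum_lt_sum (fun x _ => ?_) ⟨0, mem_univ _, by simp⟩
        by_cases hx : x ^ 3 - 8 * x ^ 2 - 2 * x = 0
        · simp [hx]
        · rcases quadraticChar_dichotomy hx with h | h <;> rw [h] <;> simp
    _ = Fintype.card k := by simp

namespace WeierstrassCurve

/-- The hypotheses are the transformation rules of the `b`-invariants `-32`, `-4` and `0` of
`y² = x³ - 8x² - 2x`. They make `u ^ 6` times the two-torsion polynomial of `W` at `x` equal to
`4 f(u ^ 2 x + r)`, where `f(x) = x³ - 8x² - 2x`. -/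
theorem sum_quadraticChar_eq_of_variableChange {k : Type*} [Field k] [Fintype k] [DecidableEq k]
    (hk : ringChar k ≠ 2) {R : Type*} [CommRing R] (f : R →+* k) (W : WeierstrassCurve R) {u r : R}
    (hu : IsUnit u) (h₂ : u ^ 2 * W.b₂ = -32 + 12 * r)
    (h₄ : u ^ 4 * W.b₄ = -4 - 32 * r + 6 * r ^ 2)
    (h₆ : u ^ 6 * W.b₆ = -8 * r - 32 * r ^ 2 + 4 * r ^ 3) :
    ∑ x : k, quadraticChar k ((W.map f).twoTorsionPolynomial.toPoly.eval x) =
      ∑ x : k, quadraticChar k (x ^ 3 - 8 * x ^ 2 - 2 * x) := by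
  have h2 : (2 : k) ≠ 0 := Ring.two_ne_zero hk
  have hu : f u ≠ 0 := (hu.map f).ne_zero
  replace h₂ := congrArg f h₂
  replace h₄ := congrArg f h₄
  replace h₆ := congrArg f h₆
  simp only [map_mul, map_add, map_sub, map_neg, map_pow, map_ofNat] at h₂ h₄ h₆
  let e : k ≃ k := (Equiv.mulLeft₀ (f u ^ 2) (pow_ne_zero 2 hu)).trans (Equiv.addRight (f r))
  rw [← Equiv.sum_comp e fun x => quadraticChar k (x ^ 3 - 8 * x ^ 2 - 2 * x)]
  refine sum_congr rfl fun x _ => ?_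
  rw [← quadraticChar_sq_mul (pow_ne_zero 3 hu), ← quadraticChar_sq_mul h2 (_ - _),
    eval_twoTorsionPolynomial, map_b₂, map_b₄, map_b₆]
  congr 1
  simp only [e, Equiv.trans_apply, Equiv.mulLeft₀_apply, Equiv.coe_addRight]
  linear_combination f u ^ 4 * x ^ 2 * h₂ + 2 * f u ^ 2 * x * h₄ + h₆

end WeierstrassCurve

theorem curveE_b₂ : curveE.b₂ = -32 := by norm_num [curveE, WeierstrassCurve.b₂]
theorem curveE_b₄ : curveE.b₄ = -4 := by norm_num [curveE, WeierstrassCurve.b₄]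
theorem curveE_b₆ : curveE.b₆ = 0 := by norm_num [curveE, WeierstrassCurve.b₆]
theorem curveE_Δ : curveE.Δ = 4608 := by
  norm_num [curveE, WeierstrassCurve.Δ, WeierstrassCurve.b₂, WeierstrassCurve.b₄,
    WeierstrassCurve.b₆, WeierstrassCurve.b₈]

open WeierstrassCurve IsLocalRing

/-- The discriminant `4608 = 2 ^ 9 * 3 ^ 2` of `E` changes by twelfth powers only, so it can become
a unit neither at `2` nor at `3`. -/
theorem Padic.norm_eq_one_of_pow_mul_eq {p : ℕ} [Fact p.Prime] {u d : ℚ_[p]} (hd : ‖d‖ = 1)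
    (h : u ^ 12 * d = 4608) : p ≠ 2 ∧ p ≠ 3 ∧ ‖u‖ = 1 := by
  have hu : u ≠ 0 := by
    rintro rfl
    norm_num at h
  have hd0 : d ≠ 0 := norm_ne_zero_iff.mp (by rw [hd]; exact one_ne_zero)
  have hdv : d.valuation = 0 := by
    have := Padic.norm_eq_zpow_neg_valuation hd0
    rw [hd] at this
    have hp1 : (1 : ℝ) < p := by exact_mod_cast (Fact.out : p.Prime).one_lt
    have := zpow_right_injective₀ (by linarith) hp1.ne' ((zpow_zero (p : ℝ)).trans this)
    omega
  have hval : 12 * u.valuation = padicValNat p 4608 := by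
    have := congrArg Padic.valuation h
    rw [Padic.valuation_mul (pow_ne_zero _ hu) hd0, Padic.valuation_pow, hdv,
      ← Nat.cast_ofNat (n := 4608), Padic.valuation_natCast] at this
    simpa using this
  have h2 : p ≠ 2 := by
    rintro rfl
    have : padicValNat 2 4608 = 9 := by
      rw [show 4608 = 2 ^ 9 * 9 by norm_num, padicValNat.mul (by norm_num) (by norm_num),
        padicValNat.prime_pow, padicValNat.eq_zero_of_not_dvd (by norm_num)]
    omega
  have h3 : p ≠ 3 := by
    rintro rfl
    have : padicValNat 3 4608 = 2 := by
      rw [show 4608 = 3 ^ 2 * 512 by norm_num, padicValNat.mul (by norm_num) (by norm_num),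
        padicValNat.prime_pow, padicValNat.eq_zero_of_not_dvd (by norm_num)]
    omega
  refine ⟨h2, h3, ?_⟩
  have : padicValNat p 4608 = 0 := by
    have hp : p.Prime := Fact.out
    refine padicValNat.eq_zero_of_not_dvd fun h => ?_
    rw [show 4608 = 2 ^ 9 * 3 ^ 2 by norm_num, hp.dvd_mul] at h
    rcases h with h | h
    · exact h2 ((Nat.prime_dvd_prime_iff_eq hp Nat.prime_two).mp (hp.dvd_of_dvd_pow h))
    · exact h3 ((Nat.prime_dvd_prime_iff_eq hp Nat.prime_three).mp (hp.dvd_of_dvd_pow h))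
  rw [Padic.norm_eq_zpow_neg_valuation hu, show u.valuation = 0 by omega, neg_zero, zpow_zero]

/-- An integral model of `E` over `ℤ_[p]` with unit discriminant arises from the given equation by a
change of variables whose `u` is a unit and whose `r` is integral. -/
theorem exists_variableChange_of_isUnit_Δ {p : ℕ} [Fact p.Prime] {I : WeierstrassCurve ℤ_[p]}
    {C : VariableChange ℚ_[p]} (hI : I.baseChange ℚ_[p] = C • curveE.baseChange ℚ_[p])
    (hΔ : IsUnit I.Δ) : p ≠ 2 ∧ p ≠ 3 ∧ ∃ u r : ℤ_[p], IsUnit u ∧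
      u ^ 2 * I.b₂ = -32 + 12 * r ∧ u ^ 4 * I.b₄ = -4 - 32 * r + 6 * r ^ 2 ∧
      u ^ 6 * I.b₆ = -8 * r - 32 * r ^ 2 + 4 * r ^ 3 := by
  have hu0 : (C.u : ℚ_[p]) ≠ 0 := C.u.ne_zero
  have eΔ := congrArg WeierstrassCurve.Δ hI
  have e₂ := congrArg WeierstrassCurve.b₂ hI
  have e₄ := congrArg WeierstrassCurve.b₄ hI
  have e₆ := congrArg WeierstrassCurve.b₆ hI
  simp only [variableChange_Δ, variableChange_b₂, variableChange_b₄, variableChange_b₆, baseChange,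
    map_Δ, map_b₂, map_b₄, map_b₆, curveE_Δ, curveE_b₂, curveE_b₄, curveE_b₆, map_neg, map_zero,
    map_ofNat, PadicInt.algebraMap_apply, Units.val_inv_eq_inv_val] at eΔ e₂ e₄ e₆
  replace eΔ : (C.u : ℚ_[p]) ^ 12 * I.Δ = 4608 := by rw [eΔ]; field_simp
  replace e₂ : (C.u : ℚ_[p]) ^ 2 * I.b₂ = -32 + 12 * C.r := by rw [e₂]; field_simp
  replace e₄ : (C.u : ℚ_[p]) ^ 4 * I.b₄ = -4 - 32 * C.r + 6 * C.r ^ 2 := by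
    rw [e₄]; field_simp; ring
  replace e₆ : (C.u : ℚ_[p]) ^ 6 * I.b₆ = -8 * C.r - 32 * C.r ^ 2 + 4 * C.r ^ 3 := by
    rw [e₆]; field_simp; ring
  obtain ⟨h2, h3, hu⟩ := Padic.norm_eq_one_of_pow_mul_eq (by simpa using PadicInt.isUnit_iff.mp hΔ) eΔ
  have h12 : ‖(12 : ℚ_[p])‖ = 1 := by
    rw [← Nat.cast_ofNat (n := 12), Padic.norm_natCast_eq_one_iff]
    have hp : p.Prime := Fact.out
    refine (Nat.coprime_primes hp Nat.prime_two).mpr h2 |>.pow_right 2 |>.mul_right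
      ((Nat.coprime_primes hp Nat.prime_three).mpr h3)
  obtain ⟨u, hu'⟩ : ∃ u : ℤ_[p], (u : ℚ_[p]) = C.u := ⟨⟨C.u, hu.le⟩, rfl⟩
  rw [← hu'] at hu e₂ e₄ e₆
  have hr : ‖C.r‖ ≤ 1 := by
    have h : 12 * C.r = ((u ^ 2 * I.b₂ + 32 : ℤ_[p]) : ℚ_[p]) := by
      have h32 : ((32 : ℤ_[p]) : ℚ_[p]) = 32 := map_ofNat PadicInt.Coe.ringHom 32
      rw [PadicInt.coe_add, PadicInt.coe_mul, PadicInt.coe_pow, h32]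
      linear_combination -e₂
    have h' := PadicInt.norm_le_one (u ^ 2 * I.b₂ + 32)
    rwa [PadicInt.norm_def, ← h, norm_mul, h12, one_mul] at h'
  refine ⟨h2, h3, u, ⟨C.r, hr⟩, PadicInt.isUnit_iff.mpr hu, ?_, ?_, ?_⟩ <;>
    apply Subtype.coe_injective <;> push_cast
  exacts [e₂, e₄, e₆]

theorem card_residueField_padicInt (p : ℕ) [Fact p.Prime] [Fintype (ResidueField ℤ_[p])] :
    Fintype.card (ResidueField ℤ_[p]) = p := by
  rw [Fintype.card_congr PadicInt.residueField.toEquiv, ZMod.card]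

theorem mainTheorem6 (p : ℕ) [Fact p.Prime] (hp : curveE.IsSupersingularPrime p) :
    p ≡ 5 [MOD 24] ∨ p ≡ 23 [MOD 24] := by
  classical
  obtain ⟨-, hss⟩ := hp
  set I := ((curveE.baseChange ℚ_[p]).minimal ℤ_[p]).integralModel ℤ_[p]
  have hred : ((curveE.baseChange ℚ_[p]).minimal ℤ_[p]).reduction ℤ_[p] =
    I.map (residue ℤ_[p]) := rfl
  rw [hred] at hss
  have hΔ : IsUnit I.Δ := by
    have := hss.1.isUnit
    rw [map_Δ] at this
    exact (isUnit_map_iff (residue ℤ_[p]) _).mp this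
  obtain ⟨h2, h3, u, r, hu, e₂, e₄, e₆⟩ := exists_variableChange_of_isUnit_Δ
    (baseChange_integralModel_eq ℤ_[p] ((curveE.baseChange ℚ_[p]).minimal ℤ_[p])) hΔ
  have : Fintype (ResidueField ℤ_[p]) := Fintype.ofEquiv _ PadicInt.residueField.toEquiv.symm
  have hcard := card_residueField_padicInt p
  have : CharP (ResidueField ℤ_[p]) p :=
    charP_of_injective_ringHom (f := PadicInt.residueField.symm.toRingHom)
      PadicInt.residueField.symm.injective p
  have hchar : ringChar (ResidueField ℤ_[p]) = p := ringChar.eq _ p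
  have hk : ringChar (ResidueField ℤ_[p]) ≠ 2 := by rwa [hchar]
  have hsum := sum_quadraticChar_eq_neg_hasseCoeff hk (I.map (residue ℤ_[p]))
  rw [hss.hasseCoeff_eq_zero hk, neg_zero,
    sum_quadraticChar_eq_of_variableChange hk _ I hu e₂ e₄ e₆] at hsum
  have := card_mod_of_sum_eq_zero hk (by rwa [hchar]) (by
    rw [hcard]
    intro h
    exact h3 ((Nat.prime_dvd_prime_iff_eq Nat.prime_three Fact.out).mp
      (Nat.dvd_of_mod_eq_zero h)).symm)
    (sum_quadraticChar_eq_zero_of_intCast_eq_zero (hcard.trans hchar.symm) hsum)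
  rw [hcard] at this
  exact this
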